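/- Consider the Delayed Feedback Vertex Set problem with reservations, for a constant reservation cost $\alpha\in\mathbb{R}_{\ge 0}$. An instance is a finite simple graph $G$ whose vertices $v_1,\dots,v_n$ are presented one after the other, each together with its edges to the previous vertices. After $v_i$ has been presented, a (deterministic) online algorithm must fix, depending only on the graph $G[\{v_1,\dots,v_i\}]$ revealed so far (with its order of presentation), sets $S_i,R_i\subseteq\{v_1,\dots,v_i\}$ of selected and of reserved vertices such that $S_1\subseteq\dots\subseteq S_n$, $R_1\subseteq\dots\subseteq R_n$, and $G[\{v_1,\dots,v_i\}\setminus(S_i\cup R_i)]$ is cycle-free for every $i$. Its cost on $G$ is $|S_n|+|T|+\alpha|R_n|$, where $T\subseteq V(G)$ is a set of minimum size such that $G-(S_n\cup T)$ is cycle-free. The algorithm is (strictly) $c$-competitive if on every instance $G$ its cost is at most $c\cdot\mathrm{OPT}(G)$, where $\mathrm{OPT}(G)$ is the minimum size of a feedback vertex set of $G$, i.e. of a set of vertices whose deletion leaves a cycle-free graph. Then for every $\alpha\ge 0$ there is a $\min\{5,\,1+5\alpha\}$-competitive algorithm for the Delayed Feedback Vertex Set problem with reservations. -/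

import Mathlib

/-! Feedback vertex set, online, with delayed decisions and reservations.

An online instance with `n` vertices is a finite simple graph `G` on `Fin n`; the vertices are
presented in their natural order, each together with its edges to the vertices before it. -/

namespace DelayedFVS

/-- `S` is a feedback vertex set of `G`: deleting `S` leaves a cycle-free graph. -/
def IsFVS {V : Type*} (G : SimpleGraph V) (S : Set V) : Prop :=
  (G.induce Sᶜ).IsAcyclic

/-- The graph that has been revealed once the first `i` vertices of `G` have been presented,
that is, the subgraph of `G` induced by these vertices. -/
def revealed {n : ℕ} (G : SimpleGraph (Fin n)) (i : ℕ) (hi : i ≤ n) : SimpleGraph (Fin i) :=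
  G.comap (Fin.castLE hi)

/-- The least number of vertices which, together with `S`, form a feedback vertex set of `G`. -/
noncomputable def completionSize {n : ℕ} (G : SimpleGraph (Fin n)) (S : Finset (Fin n)) : ℕ :=
  sInf {k : ℕ | ∃ T : Finset (Fin n), IsFVS G ((S : Set (Fin n)) ∪ (T : Set (Fin n))) ∧ T.card = k}

/-- The optimal offline cost: the least size of a feedback vertex set of `G`. -/
noncomputable def opt {n : ℕ} (G : SimpleGraph (Fin n)) : ℕ :=
  sInf {k : ℕ | ∃ S : Finset (Fin n), IsFVS G (S : Set (Fin n)) ∧ S.card = k}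

theorem isFVS_univ {V : Type*} (G : SimpleGraph V) : IsFVS G Set.univ := by
  intro v
  exact absurd (Set.mem_univ v.1) v.2

/-- The set of candidates in `completionSize` is not empty, so its infimum is a minimum. -/
theorem completionSize_spec {n : ℕ} (G : SimpleGraph (Fin n)) (S : Finset (Fin n)) :
    ∃ T : Finset (Fin n), IsFVS G ((S : Set (Fin n)) ∪ (T : Set (Fin n))) ∧
      T.card = completionSize G S := by
  refine Nat.sInf_mem (s := {k : ℕ | ∃ T : Finset (Fin n),
    IsFVS G ((S : Set (Fin n)) ∪ (T : Set (Fin n))) ∧ T.card = k}) ⟨_, Finset.univ, ?_, rfl⟩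
  simpa using isFVS_univ G

/-- The set of candidates in `opt` is not empty, so its infimum is a minimum. -/
theorem opt_spec {n : ℕ} (G : SimpleGraph (Fin n)) :
    ∃ S : Finset (Fin n), IsFVS G (S : Set (Fin n)) ∧ S.card = opt G := by
  refine Nat.sInf_mem (s := {k : ℕ | ∃ S : Finset (Fin n),
    IsFVS G (S : Set (Fin n)) ∧ S.card = k}) ⟨_, Finset.univ, ?_, rfl⟩
  simpa using isFVS_univ G

/-- A deterministic online strategy: a rule that gives, from the graph revealed so far (and
nothing else, in particular not the length of the instance), the set of all vertices selected
so far and the set of all vertices reserved so far. -/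
structure OnlineStrategy where
  select : (i : ℕ) → SimpleGraph (Fin i) → Finset (Fin i)
  reserve : (i : ℕ) → SimpleGraph (Fin i) → Finset (Fin i)

namespace OnlineStrategy

/-- `S_i`: the vertices selected after the first `i` vertices of `G` have been presented. -/
def selected (A : OnlineStrategy) {n : ℕ} (G : SimpleGraph (Fin n)) (i : ℕ) (hi : i ≤ n) :
    Finset (Fin n) :=
  (A.select i (revealed G i hi)).map (Fin.castLEEmb hi)

/-- `R_i`: the vertices reserved after the first `i` vertices of `G` have been presented. -/
def reserved (A : OnlineStrategy) {n : ℕ} (G : SimpleGraph (Fin n)) (i : ℕ) (hi : i ≤ n) :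
    Finset (Fin n) :=
  (A.reserve i (revealed G i hi)).map (Fin.castLEEmb hi)

/-- `A` is an algorithm for the delayed feedback vertex set problem with reservations: on every
instance selections and reservations are never revoked, and after every step the revealed graph
without the selected and the reserved vertices is cycle-free. -/
structure IsAlgorithm (A : OnlineStrategy) : Prop where
  selected_mono : ∀ (n : ℕ) (G : SimpleGraph (Fin n)) (i j : ℕ) (hij : i ≤ j) (hj : j ≤ n),
    A.selected G i (hij.trans hj) ⊆ A.selected G j hj
  reserved_mono : ∀ (n : ℕ) (G : SimpleGraph (Fin n)) (i j : ℕ) (hij : i ≤ j) (hj : j ≤ n),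
    A.reserved G i (hij.trans hj) ⊆ A.reserved G j hj
  valid : ∀ (n : ℕ) (G : SimpleGraph (Fin n)) (i : ℕ) (hi : i ≤ n),
    (G.induce {v : Fin n | v.val < i ∧ v ∉ A.selected G i hi ∧ v ∉ A.reserved G i hi}).IsAcyclic

/-- The cost `|S_n| + |T| + α |R_n|` of `A` on `G`, where `T` is a smallest set of vertices that
completes `S_n` to a feedback vertex set of `G` when the instance has ended. -/
noncomputable def cost (A : OnlineStrategy) (α : ℝ) {n : ℕ} (G : SimpleGraph (Fin n)) : ℝ :=
  ((A.selected G n le_rfl).card : ℝ) + (completionSize G (A.selected G n le_rfl) : ℝ)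
    + α * ((A.reserved G n le_rfl).card : ℝ)

/-- `A` is (strictly) `c`-competitive for the reservation cost `α`. -/
def IsCompetitive (A : OnlineStrategy) (α c : ℝ) : Prop :=
  ∀ (n : ℕ) (G : SimpleGraph (Fin n)), A.cost α G ≤ c * (opt G : ℝ)

end OnlineStrategy

end DelayedFVS

/-! It suffices to maintain online a growing set that meets every revealed cycle and never exceeds
five times the optimum: selecting it costs at most 5·OPT, reserving it costs at most OPT + 5α·OPT.

The set carries a certificate, a `Config`: a subgraph H = (V, E) of maximum degree three, of degree
three only at selected vertices, together with disjoint cycles hanging at the vertices of `crit`.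
`Balanced` says |sel| ≤ base + 2(|E| - |V|) + |crit|. Let F meet every cycle. Then H - F is a
forest, so |E| - |V| is at most the sum of deg x - 1 over F ∩ V; each hanging cycle needs its own
vertex of F, of degree at most two in H; and base ≤ |F ∩ V|. So a vertex of F of degree three pays
at most 1 + 2·2 = 5 and any other at most 1 + 2 + 1 = 4 (`Balanced.card_sel_le`).

While some cycle avoids `sel`, the certificate can be enlarged without losing balance
(`exists_improves`): by an ear between two free vertices, by a cycle disjoint from everything, by a
cycle hung at an unselected vertex of H, or by a cycle that meets a single hanging cycle and is
joined to H through it. Progress is bounded, so the process ends with a set that meets all cycles. A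
certificate survives the arrival of vertices and edges (`Config.mono`), so the process resumes at
the next step and nothing is revoked. -/

namespace DelayedFVS

/-! ### Degrees in edge sets, paths, cycles and forests -/

open SimpleGraph

variable {V : Type*} [DecidableEq V] {G : SimpleGraph V}

/-- The number of edges in `E` that are incident to `x`. -/
def edgeDeg (E : Finset (Sym2 V)) (x : V) : ℕ := (E.filter (x ∈ ·)).card

theorem edgeDeg_union_le (E E' : Finset (Sym2 V)) (x : V) :
    edgeDeg (E ∪ E') x ≤ edgeDeg E x + edgeDeg E' x := by
  unfold edgeDeg
  rw [Finset.filter_union]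
  exact Finset.card_union_le _ _

theorem edgeDeg_eq_zero {E : Finset (Sym2 V)} {x : V} (h : ∀ e ∈ E, x ∉ e) : edgeDeg E x = 0 := by
  unfold edgeDeg
  rw [Finset.card_eq_zero, Finset.filter_eq_empty_iff]
  exact fun e he => h e he

theorem edgeDeg_singleton_le (e : Sym2 V) (x : V) : edgeDeg {e} x ≤ 1 := by
  unfold edgeDeg
  exact (Finset.card_filter_le _ _).trans (by simp)

theorem edgeDeg_walk_of_notMem {a b : V} (p : G.Walk a b) {x : V} (hx : x ∉ p.support) :
    edgeDeg p.edges.toFinset x = 0 :=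
  edgeDeg_eq_zero fun e he hxe => hx (by
    rw [List.mem_toFinset] at he
    exact p.mem_support_of_mem_edges he hxe)

theorem edges_toFinset_cons {a b c : V} (h : G.Adj a b) (p : G.Walk b c) :
    (Walk.cons h p).edges.toFinset = {s(a, b)} ∪ p.edges.toFinset := by
  ext e; simp

theorem edgeDeg_path {a b : V} (p : G.Walk a b) (hp : p.IsPath) :
    edgeDeg p.edges.toFinset a ≤ 1 ∧ ∀ x, edgeDeg p.edges.toFinset x ≤ 2 := by
  induction p with
  | nil => simp [edgeDeg]
  | @cons a b c h p ih =>
    rw [Walk.cons_isPath_iff] at hp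
    obtain ⟨h1, h2⟩ := ih hp.1
    have key : ∀ x, edgeDeg (Walk.cons h p).edges.toFinset x
        ≤ edgeDeg {s(a, b)} x + edgeDeg p.edges.toFinset x := fun x => by
      rw [edges_toFinset_cons]; exact edgeDeg_union_le _ _ _
    have h0 := edgeDeg_walk_of_notMem p hp.2
    have ha : edgeDeg (Walk.cons h p).edges.toFinset a ≤ 1 := by
      have := key a
      have := edgeDeg_singleton_le s(a, b) a
      omega
    refine ⟨ha, fun x => ?_⟩
    by_cases hxa : x = a
    · subst hxa; omega
    by_cases hxb : x = b
    · subst hxb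
      have := key x
      have := edgeDeg_singleton_le s(a, x) x
      omega
    · have := key x
      have h3 : edgeDeg {s(a, b)} x = 0 := edgeDeg_eq_zero (by simp [hxa, hxb])
      have := h2 x
      omega

theorem edgeDeg_path_end {a b : V} (p : G.Walk a b) (hp : p.IsPath) :
    edgeDeg p.edges.toFinset b ≤ 1 := by
  have := (edgeDeg_path p.reverse hp.reverse).1
  simpa using this

theorem edgeDeg_cycle {a : V} (c : G.Walk a a) (hc : c.IsCycle) (x : V) :
    edgeDeg c.edges.toFinset x ≤ 2 := by
  cases c with
  | nil => simp [edgeDeg]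
  | @cons _ b _ h p =>
    have hp := ((Walk.cons_isCycle_iff _ _).1 hc).1
    obtain ⟨h1, h2⟩ := edgeDeg_path p hp
    have h3 := edgeDeg_path_end p hp
    have key : edgeDeg (Walk.cons h p).edges.toFinset x
        ≤ edgeDeg {s(a, b)} x + edgeDeg p.edges.toFinset x := by
      rw [edges_toFinset_cons]; exact edgeDeg_union_le _ _ _
    have h4 := edgeDeg_singleton_le s(a, b) x
    by_cases hxa : x = a
    · subst hxa; omega
    by_cases hxb : x = b
    · subst hxb; omega
    have h3 : edgeDeg {s(a, b)} x = 0 := edgeDeg_eq_zero (by simp [hxa, hxb])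
    have := h2 x
    omega

theorem card_edges_of_isTrail {a b : V} {p : G.Walk a b} (hp : p.IsTrail) :
    p.edges.toFinset.card = p.length := by
  rw [List.toFinset_card_of_nodup hp.edges_nodup, Walk.length_edges]

theorem card_support_of_isPath {a b : V} {p : G.Walk a b} (hp : p.IsPath) :
    p.support.toFinset.card = p.length + 1 := by
  rw [List.toFinset_card_of_nodup hp.support_nodup, Walk.length_support]

theorem card_support_of_isCycle {a : V} {c : G.Walk a a} (hc : c.IsCycle) :
    c.support.toFinset.card = c.length := by
  cases c with
  | nil => exact absurd rfl hc.ne_nil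
  | cons h p =>
    have hp := ((Walk.cons_isCycle_iff _ _).1 hc).1
    have h1 : (Walk.cons h p).support.toFinset = p.support.toFinset := by
      ext x; simp only [Walk.support_cons, List.mem_toFinset, List.mem_cons]
      exact ⟨fun h => h.elim (fun h => h ▸ p.end_mem_support) id, Or.inr⟩
    rw [h1, card_support_of_isPath hp, Walk.length_cons]

theorem exists_two_edges_of_isCycle {a x : V} {c : G.Walk a a} (hc : c.IsCycle)
    (hx : x ∈ c.support) : ∃ y z, y ≠ z ∧ s(x, y) ∈ c.edges ∧ s(x, z) ∈ c.edges := by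
  have hc' := hc.rotate hx
  have hnil : ¬ (c.rotate x hx).Nil := hc'.not_nil
  refine ⟨_, _, hc'.snd_ne_penultimate, ?_, ?_⟩
  · exact (c.rotate_edges x hx).mem_iff.1 (Walk.mk_start_snd_mem_edges hnil)
  · rw [Sym2.eq_swap]
    exact (c.rotate_edges x hx).mem_iff.1 (Walk.mk_penultimate_end_mem_edges hnil)

/-- A cycle that avoids the start of a path whose other vertices, except possibly the last, carry no
edge of `E` cannot use the edges of the path. -/
theorem cycle_edges_subset_of_start_notMem {E : Finset (Sym2 V)} {a b : V} (p : G.Walk a b)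
    (hp : p.IsPath) (hE : ∀ x ∈ p.support, x ≠ a → x ≠ b → ∀ e ∈ E, x ∉ e) {v : V}
    (c : G.Walk v v) (hc : c.IsCycle) (hcE : ∀ e ∈ c.edges, e ∈ E ∨ e ∈ p.edges)
    (ha : a ∉ c.support) : ∀ e ∈ c.edges, e ∈ E := by
  induction p with
  | nil => simpa using hcE
  | @cons a a' b h p ih =>
    have hp' := (Walk.cons_isPath_iff _ _).1 hp
    have hcE' : ∀ e ∈ c.edges, e ∈ E ∨ e ∈ p.edges := by
      intro e he
      rcases hcE e he with h1 | h1
      · exact Or.inl h1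
      · rw [Walk.edges_cons, List.mem_cons] at h1
        rcases h1 with rfl | h1
        · exact absurd (c.fst_mem_support_of_mem_edges he) ha
        · exact Or.inr h1
    have hne : ∀ x ∈ p.support, x ≠ a := fun x hx hxa => hp'.2 (hxa ▸ hx)
    by_cases hab : a' = b
    · subst hab
      have : p = Walk.nil := (Walk.isPath_iff_nil (p := p)).1 hp'.1 |>.eq_nil
      subst this
      simpa using hcE'
    refine ih hp'.1 (fun x hx _ hxb => hE x (by simp [hx]) (hne x hx) hxb) hcE' ?_
    intro ha'
    obtain ⟨y, z, hyz, hy, hz⟩ := exists_two_edges_of_isCycle hc ha'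
    have hEa' := hE a' (by simp) (hne a' p.start_mem_support) hab
    -- No edge of `E` meets `a'`, so both edges of `c` at `a'` lie on `p`; but a path has only one
    -- edge at its start.
    have aux : ∀ w, s(a', w) ∈ c.edges → w = p.snd := fun w hw =>
      ((hcE' _ hw).resolve_left fun h => hEa' _ h (by simp)) |> hp'.1.eq_snd_of_mem_edges
    exact hyz ((aux y hy).trans (aux z hz).symm)

/-- Truncation at the first vertex in `P`; it later makes an ear meet a new cycle only in its last
vertex. -/
theorem exists_walk_first_hit {W : Type*} {G : SimpleGraph W} {a b : W} (p : G.Walk a b)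
    (P : W → Prop) (hb : P b) :
    ∃ w, ∃ q : G.Walk a w, P w ∧ (∀ z ∈ q.support, z ∈ p.support) ∧
      (∀ e ∈ q.edges, e ∈ p.edges) ∧ ∀ z ∈ q.support, P z → z = w := by
  induction p with
  | nil => exact ⟨_, Walk.nil, hb, by simp, by simp, by simp⟩
  | @cons a a' b h p ih =>
    by_cases ha : P a
    · exact ⟨a, Walk.nil, ha, by simp, by simp, by simp⟩
    obtain ⟨w, q, h1, h2, h3, h4⟩ := ih hb
    refine ⟨w, Walk.cons h q, h1, ?_, ?_, ?_⟩
    · intro z hz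
      rw [Walk.support_cons, List.mem_cons] at hz ⊢
      exact hz.imp id (h2 z)
    · intro z hz
      rw [Walk.edges_cons, List.mem_cons] at hz ⊢
      exact hz.imp id (h3 z)
    · intro z hz hPz
      rw [Walk.support_cons, List.mem_cons] at hz
      rcases hz with rfl | hz
      · exact absurd hPz ha
      · exact h4 z hz hPz

theorem card_edgeFinset_le_of_isAcyclic {W : Type*} [Fintype W] (H : SimpleGraph W)
    [Fintype H.edgeSet] (hH : H.IsAcyclic) : H.edgeFinset.card ≤ Fintype.card W := by
  classical
  cases isEmpty_or_nonempty W
  · have : H.edgeFinset = ∅ := by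
      ext e; induction e using Sym2.ind with | _ x y => exact isEmptyElim x
    simp [this]
  -- A forest extends to a spanning tree of the complete graph, which has one edge fewer than
  -- vertices.
  · obtain ⟨T, hT, -, h2⟩ := (connected_top (V := W)).exists_isTree_le_of_le_of_isAcyclic
      (H := H) le_top hH
    have h3 := h2.card_edgeFinset
    have h4 := Finset.card_le_card (edgeFinset_mono hT)
    omega

/-- A finite set of edges without cycles has at most as many edges as endpoints. -/
theorem card_le_card_of_forest {E : Finset (Sym2 V)} {U : Finset V} (hE : ∀ e ∈ E, e ∈ G.edgeSet)
    (hU : ∀ e ∈ E, ∀ x ∈ e, x ∈ U)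
    (hcyc : ∀ (v : V) (c : G.Walk v v), c.IsCycle → ¬ ∀ e ∈ c.edges, e ∈ E) :
    E.card ≤ U.card := by
  classical
  let H := (fromEdgeSet (E : Set (Sym2 V))).induce (U : Set V)
  have hle : fromEdgeSet (E : Set (Sym2 V)) ≤ G := fun x y h =>
    hE _ ((fromEdgeSet_adj _).1 h).1
  have hH : H.IsAcyclic := by
    refine IsAcyclic.induce (fun v c hc => ?_) _
    refine hcyc v (c.mapLe hle) (hc.mapLe hle) fun e he => ?_
    rw [Walk.edges_mapLe_eq_edges] at he
    have := c.edges_subset_edgeSet he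
    rw [edgeSet_fromEdgeSet] at this
    exact this.1
  have h1 := card_edgeFinset_le_of_isAcyclic H hH
  have h2 : E ⊆ H.edgeFinset.image (Sym2.map Subtype.val) := by
    intro e he
    induction e using Sym2.ind with | _ x y =>
    rw [Finset.mem_image]
    refine ⟨s(⟨x, hU _ he x (by simp)⟩, ⟨y, hU _ he y (by simp)⟩), ?_, rfl⟩
    rw [mem_edgeFinset, mem_edgeSet]
    exact (fromEdgeSet_adj _).2 ⟨he, (show G.Adj x y from hE _ he).ne⟩
  have h3 := (Finset.card_le_card h2).trans Finset.card_image_le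
  have h4 : Fintype.card (U : Set V) = U.card := by simp
  omega

end DelayedFVS

/-! ### Configurations and the bound by five times a feedback vertex set -/

namespace DelayedFVS

open SimpleGraph

/-- `F` meets every cycle of `G`. -/
def HitsCycles {V : Type*} (G : SimpleGraph V) (F : Finset V) : Prop :=
  ∀ (v : V) (c : G.Walk v v), c.IsCycle → ∃ y ∈ c.support, y ∈ F

/-- A subgraph of `G` of maximum degree three (`verts`, `edges`), the selected vertices `sel` on it,
and, for the selected vertices in `crit`, pairwise disjoint cycles of `G` that meet the
subgraph only in their base vertex. `label x = some u` says that `x = u` lies on the subgraph or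
that `x` lies on the cycle attached at `u`. Every feedback vertex set has at least `base` vertices on
the subgraph. -/
structure Config {V : Type*} [DecidableEq V] (G : SimpleGraph V) where
  sel : Finset V
  verts : Finset V
  edges : Finset (Sym2 V)
  crit : Finset V
  label : V → Option V
  base : ℕ
  edges_sub : ∀ e ∈ edges, e ∈ G.edgeSet
  mem_verts : ∀ e ∈ edges, ∀ x ∈ e, x ∈ verts
  deg_le_three : ∀ x, edgeDeg edges x ≤ 3
  deg_le_two : ∀ x, x ∉ sel → edgeDeg edges x ≤ 2
  crit_deg : ∀ x ∈ crit, edgeDeg edges x ≤ 2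
  crit_sel : ∀ x ∈ crit, x ∈ sel
  crit_verts : ∀ x ∈ crit, x ∈ verts
  label_self : ∀ x ∈ verts, label x = some x
  label_verts : ∀ x u, label x = some u → u ∈ verts
  label_crit : ∀ x u, label x = some u → x ≠ u → u ∈ crit
  crit_cycle : ∀ u ∈ crit, ∃ c : G.Walk u u, c.IsCycle ∧ ∀ x, label x = some u ↔ x ∈ c.support
  base_le : ∀ F : Finset V, HitsCycles G F → base ≤ (F ∩ verts).card
  hits : ∀ (v : V) (c : G.Walk v v), c.IsCycle → (∀ e ∈ c.edges, e ∈ edges) →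
    ∃ y ∈ c.support, y ∈ sel

namespace Config

variable {V : Type*} [DecidableEq V] {G : SimpleGraph V}

/-- The accounting invariant: the selected vertices are paid for by `base`, by the cyclomatic
excess of the subgraph and by the attached cycles. -/
def Balanced (σ : Config G) : Prop :=
  σ.sel.card + 2 * σ.verts.card ≤ σ.base + 2 * σ.edges.card + σ.crit.card

theorem edgeDeg_eq_zero_of_notMem (σ : Config G) {x : V} (hx : x ∉ σ.verts) :
    edgeDeg σ.edges x = 0 :=
  edgeDeg_eq_zero fun e he hxe => hx (σ.mem_verts e he x hxe)

/-- Labels separate the hanging cycles, so each contains a private vertex of `F`. That vertex is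
either the critical base itself, of degree at most two, or off the subgraph, of degree zero. -/
theorem card_crit_le (σ : Config G) {F : Finset V} (hF : HitsCycles G F) :
    σ.crit.card ≤ (F.filter (edgeDeg σ.edges · ≤ 2)).card := by
  have h : ∀ u ∈ σ.crit, ∃ y ∈ F, σ.label y = some u := by
    intro u hu
    obtain ⟨c, hc, hl⟩ := σ.crit_cycle u hu
    obtain ⟨y, hy, hyF⟩ := hF u c hc
    exact ⟨y, hyF, (hl y).2 hy⟩
  choose! f hfF hfl using h
  refine Finset.card_le_card_of_injOn f ?_ ?_
  · intro u hu
    refine Finset.mem_coe.2 (Finset.mem_filter.2 ⟨hfF u hu, ?_⟩)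
    by_cases hv : f u ∈ σ.verts
    · have h1 := σ.label_self _ hv
      rw [hfl u hu, Option.some_inj] at h1
      rw [← h1]
      exact σ.crit_deg u hu
    · rw [σ.edgeDeg_eq_zero_of_notMem hv]; omega
  · intro u hu v hv huv
    have h1 := hfl u hu
    rw [huv, hfl v hv, Option.some_inj] at h1
    exact h1.symm

/-- Edges that avoid `F` form a forest on `verts \ F`; the others are counted at an endpoint in `F`.
-/
theorem card_edges_le (σ : Config G) {F : Finset V} (hF : HitsCycles G F) :
    σ.edges.card ≤ (σ.verts \ F).card + ∑ x ∈ F ∩ σ.verts, edgeDeg σ.edges x := by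
  classical
  rw [← Finset.card_filter_add_card_filter_not (s := σ.edges) (fun e => ∀ x ∈ F, x ∉ e)]
  refine Nat.add_le_add ?_ ?_
  · refine card_le_card_of_forest (G := G) (fun e he => σ.edges_sub e (Finset.mem_filter.1 he).1)
      (fun e he x hx => ?_) fun v c hc hce => ?_
    · rw [Finset.mem_filter] at he
      exact Finset.mem_sdiff.2 ⟨σ.mem_verts e he.1 x hx, fun hxF => he.2 x hxF hx⟩
    · obtain ⟨y, hy, hyF⟩ := hF v c hc
      obtain ⟨z, -, -, hz, -⟩ := exists_two_edges_of_isCycle hc hy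
      exact (Finset.mem_filter.1 (hce _ hz)).2 y hyF (by simp)
  · refine le_trans (Finset.card_le_card ?_) Finset.card_biUnion_le
    intro e he
    rw [Finset.mem_filter] at he
    obtain ⟨he, h⟩ := he
    push Not at h
    obtain ⟨x, hxF, hxe⟩ := h
    exact Finset.mem_biUnion.2 ⟨x, Finset.mem_inter.2 ⟨hxF, σ.mem_verts e he x hxe⟩,
      Finset.mem_filter.2 ⟨he, hxe⟩⟩

/-- Substituting the three bounds into the balance charges each vertex of `F`: at most 1 + 2·(3 - 1)
if it has degree three, at most 1 + 2·(2 - 1) + 1 if it is another vertex of the subgraph, and at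
most 1 off the subgraph. -/
theorem Balanced.card_sel_le {σ : Config G} (hσ : σ.Balanced) {F : Finset V}
    (hF : HitsCycles G F) : σ.sel.card ≤ 5 * F.card := by
  have h1 := σ.card_crit_le hF
  have h2 := σ.card_edges_le hF
  have h3 := σ.base_le F hF
  have h4 : (σ.verts \ F).card + (F ∩ σ.verts).card = σ.verts.card := by
    rw [Finset.inter_comm]; exact Finset.card_sdiff_add_card_inter _ _
  have h5 := Finset.card_filter_add_card_filter_not (s := F ∩ σ.verts) (edgeDeg σ.edges · ≤ 2)
  have h6 := Finset.card_filter_add_card_filter_not (s := F) (edgeDeg σ.edges · ≤ 2)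
  have h7 : (F.filter (¬ edgeDeg σ.edges · ≤ 2)) =
      ((F ∩ σ.verts).filter (¬ edgeDeg σ.edges · ≤ 2)) := by
    ext x
    simp only [Finset.mem_filter, Finset.mem_inter]
    refine ⟨fun h => ⟨⟨h.1, ?_⟩, h.2⟩, fun h => ⟨h.1.1, h.2⟩⟩
    by_contra hx
    have := σ.edgeDeg_eq_zero_of_notMem hx
    omega
  have h8 : ∑ x ∈ F ∩ σ.verts, edgeDeg σ.edges x ≤
      2 * ((F ∩ σ.verts).filter (edgeDeg σ.edges · ≤ 2)).card +
      3 * ((F ∩ σ.verts).filter (¬ edgeDeg σ.edges · ≤ 2)).card := by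
    rw [← Finset.sum_filter_add_sum_filter_not (F ∩ σ.verts) (edgeDeg σ.edges · ≤ 2)]
    refine Nat.add_le_add ?_ ?_
    · rw [mul_comm, ← smul_eq_mul]
      exact Finset.sum_le_card_nsmul _ _ _ fun x hx => (Finset.mem_filter.1 hx).2
    · rw [mul_comm, ← smul_eq_mul]
      exact Finset.sum_le_card_nsmul _ _ _ fun x _ => σ.deg_le_three x
  have h9 : (F ∩ σ.verts).card ≤ F.card := Finset.card_le_card Finset.inter_subset_left
  rw [h7] at h6
  unfold Balanced at hσ
  omega

/-! ### Three ways to enlarge a configuration -/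

/-- Adding an ear: a walk between two vertices of degree at most two that meets, apart from its
ends, neither the subgraph nor any of the cycles attached elsewhere. -/
theorem exists_add_ear (σ : Config G) {a b : V} (hab : a ≠ b) (ha : a ∈ σ.verts)
    (hb : b ∈ σ.verts) (hda : edgeDeg σ.edges a ≤ 2) (hdb : edgeDeg σ.edges b ≤ 2)
    (w : G.Walk a b)
    (hl : ∀ z ∈ w.support, σ.label z = none ∨ σ.label z = some a ∨ σ.label z = some b)
    (he : ∀ e ∈ w.edges, e ∉ σ.edges) :
    ∃ τ : Config G, τ.sel = insert a (insert b σ.sel) ∧ τ.crit = (σ.crit.erase a).erase b ∧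
      τ.base = σ.base ∧ τ.edges.card + σ.verts.card = σ.edges.card + τ.verts.card + 1 ∧
      σ.edges.card < τ.edges.card := by
  obtain ⟨p, hp, hpl, hpe⟩ : ∃ p : G.Walk a b, p.IsPath ∧
      (∀ z ∈ p.support, σ.label z = none ∨ σ.label z = some a ∨ σ.label z = some b) ∧
      ∀ e ∈ p.edges, e ∉ σ.edges :=
    ⟨w.bypass, w.bypass_isPath, fun z hz => hl z (w.support_bypass_subset_support hz),
      fun e h => he e (w.edges_bypass_subset_edges h)⟩
  have hv : ∀ z ∈ p.support, z ∈ σ.verts → z = a ∨ z = b := by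
    intro z hz hzv
    have := hpl z hz
    rw [σ.label_self z hzv] at this
    simpa using this
  have has := p.start_mem_support
  have hbs := p.end_mem_support
  have hdeg : ∀ x, x ≠ a → x ≠ b →
      edgeDeg (σ.edges ∪ p.edges.toFinset) x ≤ max 2 (edgeDeg σ.edges x) := by
    intro x hxa hxb
    have h1 := edgeDeg_union_le σ.edges p.edges.toFinset x
    by_cases hx : x ∈ p.support
    · have h2 := (edgeDeg_path p hp).2 x
      have h3 := σ.edgeDeg_eq_zero_of_notMem (x := x) fun h => by
        rcases hv x hx h with h | h <;> contradiction
      omega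
    · have h2 := edgeDeg_walk_of_notMem p hx
      omega
  have hinter : σ.verts ∩ p.support.toFinset = {a, b} := by
    ext z
    simp only [Finset.mem_inter, List.mem_toFinset, Finset.mem_insert, Finset.mem_singleton]
    constructor
    · exact fun h => hv z h.2 h.1
    · rintro (rfl | rfl)
      · exact ⟨ha, has⟩
      · exact ⟨hb, hbs⟩
  have hlen : 0 < p.length := by
    rw [Nat.pos_iff_ne_zero]
    exact fun h => hab (Walk.eq_of_length_eq_zero h)
  have hcardE : (σ.edges ∪ p.edges.toFinset).card = σ.edges.card + p.length := by
    rw [Finset.card_union_of_disjoint, card_edges_of_isTrail hp.isTrail]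
    rw [Finset.disjoint_right]
    exact fun e h => hpe e (List.mem_toFinset.1 h)
  have hcardV : (σ.verts ∪ p.support.toFinset).card + 2 = σ.verts.card + (p.length + 1) := by
    rw [← card_support_of_isPath hp, ← Finset.card_union_add_card_inter, hinter,
      Finset.card_pair hab]
  refine ⟨{
    sel := insert a (insert b σ.sel)
    verts := σ.verts ∪ p.support.toFinset
    edges := σ.edges ∪ p.edges.toFinset
    crit := (σ.crit.erase a).erase b
    -- The cycles hanging at `a` and `b` are given up: off the ear, their vertices become
    -- unlabelled.
    label := fun z => if z ∈ p.support then some z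
      else if σ.label z = some a ∨ σ.label z = some b then none else σ.label z
    base := σ.base
    edges_sub := ?_
    mem_verts := ?_
    deg_le_three := ?_
    deg_le_two := ?_
    crit_deg := ?_
    crit_sel := ?_
    crit_verts := ?_
    label_self := ?_
    label_verts := ?_
    label_crit := ?_
    crit_cycle := ?_
    base_le := ?_
    hits := ?_ }, rfl, rfl, rfl, ?_, ?_⟩
  · intro e h
    rcases Finset.mem_union.1 h with h | h
    · exact σ.edges_sub e h
    · exact p.edges_subset_edgeSet (List.mem_toFinset.1 h)
  · intro e h x hx
    rcases Finset.mem_union.1 h with h | h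
    · exact Finset.mem_union_left _ (σ.mem_verts e h x hx)
    · exact Finset.mem_union_right _
        (List.mem_toFinset.2 (p.mem_support_of_mem_edges (List.mem_toFinset.1 h) hx))
  · intro x
    have h1 := edgeDeg_union_le σ.edges p.edges.toFinset x
    by_cases hxa : x = a
    · subst hxa
      have := (edgeDeg_path p hp).1
      omega
    by_cases hxb : x = b
    · subst hxb
      have := edgeDeg_path_end p hp
      omega
    have := hdeg x hxa hxb
    have := σ.deg_le_three x
    omega
  · intro x hx
    simp only [Finset.mem_insert, not_or] at hx
    have := hdeg x hx.1 hx.2.1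
    have := σ.deg_le_two x hx.2.2
    omega
  · intro x hx
    simp only [Finset.mem_erase] at hx
    have := hdeg x hx.2.1 hx.1
    have := σ.crit_deg x hx.2.2
    omega
  · intro x hx
    simp only [Finset.mem_erase] at hx
    simp [σ.crit_sel x hx.2.2]
  · intro x hx
    simp only [Finset.mem_erase] at hx
    simp [σ.crit_verts x hx.2.2]
  · intro x hx
    by_cases h : x ∈ p.support
    · simp [h]
    · have hxv : x ∈ σ.verts := by simpa [h] using hx
      have h1 : x ≠ a := by rintro rfl; exact h has
      have h2 : x ≠ b := by rintro rfl; exact h hbs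
      simp [h, σ.label_self x hxv, h1, h2]
  · intro x u hx
    by_cases h : x ∈ p.support
    · simp only [h, if_true, Option.some_inj] at hx
      subst hx; simp [h]
    · simp only [h, if_false] at hx
      split_ifs at hx
      simp [σ.label_verts x u hx]
  · intro x u hx hxu
    by_cases h : x ∈ p.support
    · simp only [h, if_true, Option.some_inj] at hx
      exact absurd hx hxu
    · simp only [h, if_false] at hx
      split_ifs at hx with h'
      rw [hx, Option.some_inj, Option.some_inj, not_or] at h'
      simp [h', σ.label_crit x u hx hxu]
  · intro u hu
    simp only [Finset.mem_erase] at hu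
    obtain ⟨c, hc, hcl⟩ := σ.crit_cycle u hu.2.2
    refine ⟨c, hc, fun x => ?_⟩
    rw [← hcl]
    by_cases h : x ∈ p.support
    · have h1 := hpl x h
      have h2 : x ≠ u := by
        rintro rfl
        rcases hv x h (σ.crit_verts x hu.2.2) with rfl | rfl
        · exact hu.2.1 rfl
        · exact hu.1 rfl
      simp only [h, if_true, Option.some_inj, h2, false_iff]
      intro h3
      simp [h3, hu.1, hu.2.1] at h1
    · simp only [h, if_false]
      split_ifs with h'
      · constructor
        · simp
        · intro h3
          simp [h3, hu.1, hu.2.1] at h'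
      · rfl
  · intro F hF
    exact (σ.base_le F hF).trans (Finset.card_le_card
      (Finset.inter_subset_inter_left Finset.subset_union_left))
  · intro v c hc hce
    by_cases hac : a ∈ c.support
    · exact ⟨a, hac, by simp⟩
    -- Inner vertices of the ear are new, so a cycle of the new subgraph that avoids `a` cannot run
    -- along the ear and lies in the old subgraph.
    have := cycle_edges_subset_of_start_notMem (E := σ.edges) p hp (fun x hx hxa hxb e h hxe => by
      rcases hv x hx (σ.mem_verts e h x hxe) with h | h <;> contradiction) c hc
      (fun e h => by simpa using hce e h) hac
    obtain ⟨y, hy, hys⟩ := σ.hits v c hc this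
    exact ⟨y, hy, by simp [hys]⟩
  · simp only []
    omega
  · simp only []
    omega

/-- Adding a cycle that is disjoint from the subgraph and meets no attached cycle except
possibly the one at `a`, which is given up. -/
theorem exists_add_cycle (σ : Config G) {x : V} (a : V) (c : G.Walk x x) (hc : c.IsCycle)
    (hcv : ∀ z ∈ c.support, z ∉ σ.verts)
    (hl : ∀ z ∈ c.support, σ.label z = none ∨ σ.label z = some a) :
    ∃ τ : Config G, τ.sel = insert x σ.sel ∧ τ.crit = σ.crit.erase a ∧
      τ.base = σ.base + 1 ∧ τ.verts = σ.verts ∪ c.support.toFinset ∧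
      τ.edges = σ.edges ∪ c.edges.toFinset ∧
      τ.edges.card + σ.verts.card = σ.edges.card + τ.verts.card ∧
      σ.edges.card < τ.edges.card ∧
      ∀ z, τ.label z = if z ∈ c.support then some z
        else if σ.label z = some a ∧ z ∉ σ.verts then none else σ.label z := by
  have hlen : 3 ≤ c.length := hc.three_le_length
  have hcardE : (σ.edges ∪ c.edges.toFinset).card = σ.edges.card + c.length := by
    rw [Finset.card_union_of_disjoint, card_edges_of_isTrail hc.isTrail]
    rw [Finset.disjoint_left]
    intro e h h'
    rw [List.mem_toFinset] at h'
    induction e using Sym2.ind with | _ y z =>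
    exact hcv y (c.fst_mem_support_of_mem_edges h') (σ.mem_verts _ h y (by simp))
  have hcardV : (σ.verts ∪ c.support.toFinset).card = σ.verts.card + c.length := by
    rw [Finset.card_union_of_disjoint, card_support_of_isCycle hc]
    rw [Finset.disjoint_right]
    exact fun z hz => hcv z (List.mem_toFinset.1 hz)
  have hdeg : ∀ z, edgeDeg (σ.edges ∪ c.edges.toFinset) z ≤ max 2 (edgeDeg σ.edges z) := by
    intro z
    have h1 := edgeDeg_union_le σ.edges c.edges.toFinset z
    by_cases hz : z ∈ c.support
    · have h2 := edgeDeg_cycle c hc z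
      have h3 := σ.edgeDeg_eq_zero_of_notMem (hcv z hz)
      omega
    · have h2 := edgeDeg_walk_of_notMem c hz
      omega
  refine ⟨{
    sel := insert x σ.sel
    verts := σ.verts ∪ c.support.toFinset
    edges := σ.edges ∪ c.edges.toFinset
    crit := σ.crit.erase a
    -- Giving up the cycle at `a` must not unlabel `a` itself, which may remain a vertex of the
    -- subgraph.
    label := fun z => if z ∈ c.support then some z
        else if σ.label z = some a ∧ z ∉ σ.verts then none else σ.label z
    base := σ.base + 1
    edges_sub := ?_
    mem_verts := ?_
    deg_le_three := ?_
    deg_le_two := ?_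
    crit_deg := ?_
    crit_sel := ?_
    crit_verts := ?_
    label_self := ?_
    label_verts := ?_
    label_crit := ?_
    crit_cycle := ?_
    base_le := ?_
    hits := ?_ }, rfl, rfl, rfl, rfl, rfl, ?_, ?_, fun z => rfl⟩
  · intro e h
    rcases Finset.mem_union.1 h with h | h
    · exact σ.edges_sub e h
    · exact c.edges_subset_edgeSet (List.mem_toFinset.1 h)
  · intro e h x hx
    rcases Finset.mem_union.1 h with h | h
    · exact Finset.mem_union_left _ (σ.mem_verts e h x hx)
    · exact Finset.mem_union_right _
        (List.mem_toFinset.2 (c.mem_support_of_mem_edges (List.mem_toFinset.1 h) hx))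
  · intro z
    have := hdeg z
    have := σ.deg_le_three z
    omega
  · intro z hz
    simp only [Finset.mem_insert, not_or] at hz
    have := hdeg z
    have := σ.deg_le_two z hz.2
    omega
  · intro z hz
    have := hdeg z
    have := σ.crit_deg z (Finset.mem_of_mem_erase hz)
    omega
  · intro z hz
    simp [σ.crit_sel z (Finset.mem_of_mem_erase hz)]
  · intro z hz
    simp [σ.crit_verts z (Finset.mem_of_mem_erase hz)]
  · intro z hz
    by_cases h : z ∈ c.support
    · simp [h]
    · have hzv : z ∈ σ.verts := by simpa [h] using hz
      simp [h, hzv, σ.label_self z hzv]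
  · intro z u hz
    by_cases h : z ∈ c.support
    · simp only [h, if_true, Option.some_inj] at hz
      subst hz; simp [h]
    · simp only [h, if_false] at hz
      split_ifs at hz
      simp [σ.label_verts z u hz]
  · intro z u hz hzu
    by_cases h : z ∈ c.support
    · simp only [h, if_true, Option.some_inj] at hz
      exact absurd hz hzu
    · simp only [h, if_false] at hz
      split_ifs at hz with h'
      refine Finset.mem_erase.2 ⟨?_, σ.label_crit z u hz hzu⟩
      rintro rfl
      refine h' ⟨hz, fun hzv => hzu ?_⟩
      rw [σ.label_self z hzv, Option.some_inj] at hz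
      exact hz
  · intro u hu
    rw [Finset.mem_erase] at hu
    obtain ⟨d, hd, hdl⟩ := σ.crit_cycle u hu.2
    refine ⟨d, hd, fun z => ?_⟩
    rw [← hdl]
    by_cases h : z ∈ c.support
    · have h1 := hl z h
      have h2 : z ≠ u := by
        rintro rfl
        exact hcv z h (σ.crit_verts z hu.2)
      simp only [h, if_true, Option.some_inj, h2, false_iff]
      intro h3
      simp [h3, hu.1] at h1
    · simp only [h, if_false]
      split_ifs with h'
      · constructor
        · simp
        · intro h3
          simp [h3, hu.1] at h'
      · rfl
  · intro F hF
    have h1 := σ.base_le F hF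
    obtain ⟨y, hy, hyF⟩ := hF x c hc
    refine (Nat.succ_le_succ h1).trans ?_
    -- The vertex `y` of `F` on the new cycle lies off the old subgraph, so it was not counted in
    -- `base`.
    rw [Nat.succ_eq_add_one, ← Finset.card_insert_of_notMem (a := y)
      (fun h => hcv y hy (Finset.mem_inter.1 h).2)]
    refine Finset.card_le_card fun z hz => ?_
    rw [Finset.mem_insert, Finset.mem_inter] at hz
    rw [Finset.mem_inter, Finset.mem_union, List.mem_toFinset]
    rcases hz with rfl | hz
    · exact ⟨hyF, Or.inr hy⟩
    · exact ⟨hz.1, Or.inl hz.2⟩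
  · intro v d hd hde
    by_cases hxd : x ∈ d.support
    · exact ⟨x, hxd, by simp⟩
    have hdE : ∀ e ∈ d.edges, e ∈ σ.edges := by
      cases c with
      | nil => exact absurd rfl hc.ne_nil
      | @cons _ s _ h p =>
        have hp := ((Walk.cons_isCycle_iff _ _).1 hc).1
        -- Without its first edge, which `d` cannot use, the cycle is a path; reversed, it starts at
        -- the avoided vertex `x`.
        refine cycle_edges_subset_of_start_notMem (E := σ.edges) p.reverse hp.reverse
          (fun z hz _ _ e he hze => hcv z ?_ (σ.mem_verts e he z hze)) d hd (fun e he => ?_) hxd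
        · rw [Walk.support_reverse, List.mem_reverse] at hz
          simp [hz]
        · rcases Finset.mem_union.1 (hde e he) with h1 | h1
          · exact Or.inl h1
          · rw [List.mem_toFinset, Walk.edges_cons, List.mem_cons] at h1
            rcases h1 with rfl | h1
            · exact absurd (d.fst_mem_support_of_mem_edges he) hxd
            · exact Or.inr (by simpa using h1)
    obtain ⟨y, hy, hys⟩ := σ.hits v d hd hdE
    exact ⟨y, hy, by simp [hys]⟩
  · simp only []
    omega
  · simp only []
    omega

/-- Attaching a cycle to an unselected vertex of the subgraph. -/
theorem exists_attach_cycle (σ : Config G) {a : V} (ha : a ∈ σ.verts) (has : a ∉ σ.sel)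
    (c : G.Walk a a) (hc : c.IsCycle)
    (hl : ∀ z ∈ c.support, σ.label z = none ∨ σ.label z = some a) :
    ∃ τ : Config G, τ.sel = insert a σ.sel ∧ τ.crit = insert a σ.crit ∧
      τ.base = σ.base ∧ τ.verts = σ.verts ∧ τ.edges = σ.edges := by
  have hac : a ∉ σ.crit := fun h => has (σ.crit_sel a h)
  -- As `a` is unselected, no cycle hangs there yet.
  have hla : ∀ z, σ.label z = some a → z = a := fun z hz => by
    by_contra h
    exact hac (σ.label_crit z a hz h)
  refine ⟨{
    sel := insert a σ.sel
    verts := σ.verts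
    edges := σ.edges
    crit := insert a σ.crit
    label := fun z => if z ∈ c.support then some a else σ.label z
    base := σ.base
    edges_sub := σ.edges_sub
    mem_verts := σ.mem_verts
    deg_le_three := σ.deg_le_three
    deg_le_two := fun x hx => σ.deg_le_two x fun h => hx (Finset.mem_insert_of_mem h)
    crit_deg := ?_
    crit_sel := ?_
    crit_verts := ?_
    label_self := ?_
    label_verts := ?_
    label_crit := ?_
    crit_cycle := ?_
    base_le := σ.base_le
    hits := ?_ }, rfl, rfl, rfl, rfl, rfl⟩
  · intro x hx
    rcases Finset.mem_insert.1 hx with rfl | hx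
    · exact σ.deg_le_two x has
    · exact σ.crit_deg x hx
  · intro x hx
    rcases Finset.mem_insert.1 hx with rfl | hx
    · simp
    · simp [σ.crit_sel x hx]
  · intro x hx
    rcases Finset.mem_insert.1 hx with rfl | hx
    · exact ha
    · exact σ.crit_verts x hx
  · intro x hx
    have h1 := σ.label_self x hx
    split_ifs with h
    · have := hl x h
      simp only [h1, reduceCtorEq, false_or] at this
      exact this.symm
    · exact h1
  · intro x u hx
    split_ifs at hx
    · rw [Option.some_inj] at hx
      exact hx ▸ ha
    · exact σ.label_verts x u hx
  · intro x u hx hxu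
    split_ifs at hx
    · rw [Option.some_inj] at hx
      simp [hx]
    · simp [σ.label_crit x u hx hxu]
  · intro u hu
    rcases Finset.mem_insert.1 hu with rfl | hu
    · refine ⟨c, hc, fun x => ?_⟩
      split_ifs with h
      · simp [h]
      · simp only [h, iff_false]
        exact fun h' => h (hla x h' ▸ c.start_mem_support)
    · obtain ⟨d, hd, hdl⟩ := σ.crit_cycle u hu
      have hau : a ≠ u := fun h => hac (h ▸ hu)
      refine ⟨d, hd, fun x => ?_⟩
      rw [← hdl]
      split_ifs with h
      · simp only [Option.some_inj, hau, false_iff]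
        intro h'
        have := hl x h
        simp [h', hau.symm] at this
      · rfl
  · intro v d hd hde
    obtain ⟨y, hy, hys⟩ := σ.hits v d hd hde
    exact ⟨y, hy, by simp [hys]⟩

end Config

end DelayedFVS

/-! ### Finding an enlargement when some cycle is not met -/

namespace DelayedFVS

open SimpleGraph

namespace Config

variable {V : Type*} [DecidableEq V] {G : SimpleGraph V}

/-- `x` can be reached from `a` by a walk off the subgraph that meets no attached cycle except
that at `a`. -/
def Reach (σ : Config G) (a x : V) : Prop :=
  ∃ w : G.Walk a x, (∀ z ∈ w.support, σ.label z = none ∨ σ.label z = some a) ∧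
    ∀ e ∈ w.edges, e ∉ σ.edges

/-- The vertices at which an ear may be attached. -/
def Free (σ : Config G) (a : V) : Prop := a ∈ σ.verts ∧ (a ∉ σ.sel ∨ a ∈ σ.crit)

/-- There is an ear between two free vertices. -/
def HasEar (σ : Config G) : Prop :=
  ∃ a b, a ≠ b ∧ σ.Free a ∧ σ.Free b ∧ ∃ w : G.Walk a b,
    (∀ z ∈ w.support, σ.label z = none ∨ σ.label z = some a ∨ σ.label z = some b) ∧
    ∀ e ∈ w.edges, e ∉ σ.edges

theorem Free.deg_le_two {σ : Config G} {a : V} (h : σ.Free a) : edgeDeg σ.edges a ≤ 2 :=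
  h.2.elim (σ.deg_le_two a) (σ.crit_deg a)

theorem free_of_label {σ : Config G} {x a : V} (hx : x ∉ σ.sel) (h : σ.label x = some a) :
    σ.Free a := by
  refine ⟨σ.label_verts x a h, ?_⟩
  by_cases hxa : x = a
  · exact Or.inl (hxa ▸ hx)
  · exact Or.inr (σ.label_crit x a h hxa)

theorem Reach.label {σ : Config G} {a x : V} (h : σ.Reach a x) :
    σ.label x = none ∨ σ.label x = some a :=
  h.choose_spec.1 x h.choose.end_mem_support

/-- The walk runs along the hanging cycle. It uses no edge of the subgraph, since `a` is the only
vertex of the subgraph with label `a`. -/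
theorem exists_walk_of_label (σ : Config G) {a x : V} (h : σ.label x = some a) :
    ∃ w : G.Walk a x, (∀ z ∈ w.support, σ.label z = some a) ∧ ∀ e ∈ w.edges, e ∉ σ.edges := by
  obtain ⟨w, hw⟩ : ∃ w : G.Walk a x, ∀ z ∈ w.support, σ.label z = some a := by
    by_cases hxa : x = a
    · subst hxa
      exact ⟨Walk.nil, by simpa using h⟩
    · obtain ⟨c, -, hcl⟩ := σ.crit_cycle a (σ.label_crit x a h hxa)
      have hx := (hcl x).1 h
      exact ⟨c.takeUntil x hx, fun z hz => (hcl z).2 (c.support_takeUntil_subset_support hx hz)⟩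
  refine ⟨w, hw, fun e he heE => ?_⟩
  induction e using Sym2.ind with | _ y z =>
  have hy := hw y (w.fst_mem_support_of_mem_edges he)
  have hz := hw z (w.snd_mem_support_of_mem_edges he)
  rw [σ.label_self y (σ.mem_verts _ heE y (by simp)), Option.some_inj] at hy
  rw [σ.label_self z (σ.mem_verts _ heE z (by simp)), Option.some_inj] at hz
  exact (w.adj_of_mem_edges he).ne (hy.trans hz.symm)

theorem reach_of_label (σ : Config G) {a x : V} (h : σ.label x = some a) : σ.Reach a x := by
  obtain ⟨w, hw, he⟩ := σ.exists_walk_of_label h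
  exact ⟨w, fun z hz => Or.inr (hw z hz), he⟩

/-- If `y` had another label `b`, then `b` would be free, and continuing from `y` to `b` along its
hanging cycle would give an ear from `a` to `b`. -/
theorem Reach.step {σ : Config G} (hσ : ¬ σ.HasEar) {a x y : V} (ha : σ.Free a)
    (h : σ.Reach a x) (hxy : G.Adj x y) (hE : s(x, y) ∉ σ.edges) (hy : y ∉ σ.sel) :
    σ.Reach a y := by
  obtain ⟨w, hw, he⟩ := h
  have hconcat : ∀ e ∈ (w.concat hxy).edges, e ∉ σ.edges := by
    intro e h
    rw [Walk.edges_concat, List.concat_eq_append, List.mem_append, List.mem_singleton] at h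
    rcases h with h | rfl
    · exact he e h
    · exact hE
  have hsup : ∀ z ∈ (w.concat hxy).support, z ∈ w.support ∨ z = y := by
    intro z h
    rw [Walk.support_concat, List.mem_append, List.mem_singleton] at h
    exact h
  by_cases hl : σ.label y = none ∨ σ.label y = some a
  · refine ⟨w.concat hxy, fun z hz => ?_, hconcat⟩
    rcases hsup z hz with h | rfl
    · exact hw z h
    · exact hl
  · exfalso
    rw [not_or] at hl
    obtain ⟨b, hb⟩ := Option.ne_none_iff_exists'.1 hl.1
    obtain ⟨u, hu, hue⟩ := σ.exists_walk_of_label hb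
    refine hσ ⟨a, b, ?_, ha, free_of_label hy hb, (w.concat hxy).append u.reverse, ?_, ?_⟩
    · rintro rfl
      exact hl.2 hb
    · intro z hz
      rw [Walk.mem_support_append_iff, Walk.support_reverse, List.mem_reverse] at hz
      rcases hz with hz | hz
      · rcases hsup z hz with h | rfl
        · exact (hw z h).imp id Or.inl
        · exact Or.inr (Or.inr hb)
      · exact Or.inr (Or.inr (hu z hz))
    · intro e h
      rw [Walk.edges_append, List.mem_append, Walk.edges_reverse, List.mem_reverse] at h
      exact h.elim (hconcat e) (hue e)

/-- A reached vertex of the subgraph can only be `a`, so the walk could enter an edge of the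
subgraph only by leaving from `a`. The walk avoids `a` if `a` is selected; otherwise `hd` forbids
it. -/
theorem Reach.walk {σ : Config G} (hσ : ¬ σ.HasEar) {a x y : V} (ha : σ.Free a)
    (h : σ.Reach a x) (q : G.Walk x y) (hq : ∀ z ∈ q.support, z ∉ σ.sel)
    (hd : a ∉ σ.sel → ∀ d ∈ q.darts, d.fst ≠ a) : ∀ z ∈ q.support, σ.Reach a z := by
  induction q with
  | nil => simpa using h
  | @cons x x' y hadj q ih =>
    have hE : s(x, x') ∉ σ.edges := by
      intro hE
      have hl := h.label
      rw [σ.label_self x (σ.mem_verts _ hE x (by simp))] at hl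
      simp only [reduceCtorEq, Option.some_inj, false_or] at hl
      exact hd (hl ▸ hq x (by simp)) ⟨(x, x'), hadj⟩ (by simp) hl
    have h' := h.step hσ ha hadj hE (hq x' (by simp))
    have := ih h' (fun z hz => hq z (by simp [hz])) (fun has d hdq => hd has d (by simp [hdq]))
    intro z hz
    rw [Walk.support_cons, List.mem_cons] at hz
    rcases hz with rfl | hz
    · exact h
    · exact this z hz

/-- A path that left the subgraph at `x` could, in the absence of ears, only return to it at `x`,
which a path never revisits. -/
theorem edges_subset_of_path {σ : Config G} (hσ : ¬ σ.HasEar) {x y : V} (p : G.Walk x y)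
    (hp : p.IsPath) (hps : ∀ z ∈ p.support, z ∉ σ.sel) (hx : x ∈ σ.verts) (hy : y ∈ σ.verts) :
    ∀ e ∈ p.edges, e ∈ σ.edges := by
  induction p with
  | nil => simp
  | @cons x x' y hadj q ih =>
    have hp' := (Walk.cons_isPath_iff _ _).1 hp
    by_cases hE : s(x, x') ∈ σ.edges
    · have := ih hp'.1 (fun z hz => hps z (by simp [hz])) (σ.mem_verts _ hE x' (by simp)) hy
      intro e he
      rw [Walk.edges_cons, List.mem_cons] at he
      rcases he with rfl | he
      · exact hE
      · exact this e he
    · exfalso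
      have hfree : σ.Free x := ⟨hx, Or.inl (hps x (by simp))⟩
      have h := (σ.reach_of_label (σ.label_self x hx)).step hσ hfree hadj hE (hps x' (by simp))
      have h' := (h.walk hσ hfree q (fun z hz => hps z (by simp [hz]))
        (fun _ d hd hdx => hp'.2 (hdx ▸ q.dart_fst_mem_support_of_mem_darts hd))
        y q.end_mem_support).label
      rw [σ.label_self y hy] at h'
      simp only [reduceCtorEq, Option.some_inj, false_or] at h'
      exact hp'.2 (h' ▸ q.end_mem_support)

theorem dart_fst_ne_end {W : Type*} {G : SimpleGraph W} {a b : W} {p : G.Walk a b} (hp : p.IsPath) {d : G.Dart}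
    (hd : d ∈ p.darts) : d.fst ≠ b := by
  have h := hp.support_nodup
  rw [← Walk.map_fst_darts_append, List.nodup_append] at h
  exact h.2.2 _ (List.mem_map_of_mem hd) _ (by simp)

theorem reach_of_cycle {σ : Config G} (hσ : ¬ σ.HasEar) {a x : V} (c : G.Walk x x)
    (hc : c.IsCycle) (hcs : ∀ z ∈ c.support, z ∉ σ.sel) (hx : σ.label x = some a) :
    ∀ z ∈ c.support, σ.Reach a z := by
  have hfree := free_of_label (hcs x c.start_mem_support) hx
  have hreach := σ.reach_of_label hx
  by_cases ha : a ∈ σ.crit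
  · exact hreach.walk hσ hfree c hcs fun h => absurd (σ.crit_sel a ha) h
  have hxa : x = a := by
    by_contra h
    exact ha (σ.label_crit x a hx h)
  subst hxa
  cases c with
  | nil => exact absurd rfl hc.ne_nil
  | @cons _ s _ h p =>
    have hp := ((Walk.cons_isCycle_iff _ _).1 hc).1
    have hps : ∀ z ∈ p.support, z ∉ σ.sel := fun z hz => hcs z (by simp [hz])
    -- A first edge in the subgraph would force the whole cycle into it, against `hits`; otherwise
    -- the rest of the cycle returns to `x` only at its end.
    by_cases hE : s(x, s) ∈ σ.edges
    · exfalso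
      have h1 := edges_subset_of_path hσ p hp hps (σ.mem_verts _ hE s (by simp)) hfree.1
      obtain ⟨y, hy, hys⟩ := σ.hits _ _ hc fun e he => by
        rw [Walk.edges_cons, List.mem_cons] at he
        rcases he with rfl | he
        · exact hE
        · exact h1 e he
      exact hcs y hy hys
    · have h1 := hreach.step hσ hfree h hE (hps s p.start_mem_support)
      have h2 := h1.walk hσ hfree p hps fun _ d hd => dart_fst_ne_end hp hd
      intro z hz
      rw [Walk.support_cons, List.mem_cons] at hz
      rcases hz with rfl | hz
      · exact hreach
      · exact h2 z hz

/-- Each end of an ear costs one unit: it is newly selected or it ceases to be critical. The two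
ends use up the 2 gained from the increase of |E| - |V|. -/
theorem card_insert_add_card_le {S C : Finset V} (h : C ⊆ S) (a : V) :
    (insert a S).card + C.card ≤ S.card + (C.erase a).card + 1 := by
  by_cases ha : a ∈ C
  · rw [Finset.insert_eq_of_mem (h ha)]
    have := Finset.card_erase_add_one ha
    omega
  · rw [Finset.erase_eq_of_notMem ha]
    have := Finset.card_insert_le a S
    omega

/-- `τ` is balanced, selects at least what `σ` selects, and has made progress. -/
def Improves (τ σ : Config G) : Prop :=
  τ.Balanced ∧ σ.sel ⊆ τ.sel ∧ σ.edges.card + σ.sel.card < τ.edges.card + τ.sel.card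

theorem exists_improves_of_hasEar {σ : Config G} (hb : σ.Balanced) (h : σ.HasEar) :
    ∃ τ : Config G, τ.Improves σ := by
  obtain ⟨a, b, hab, ha, hb', w, hw, he⟩ := h
  obtain ⟨τ, h1, h2, h3, h4, h5⟩ :=
    σ.exists_add_ear hab ha.1 hb'.1 ha.deg_le_two hb'.deg_le_two w hw he
  have hsub : σ.sel ⊆ τ.sel := by
    rw [h1]
    exact (Finset.subset_insert _ _).trans (Finset.subset_insert _ _)
  have h6 := Finset.card_le_card hsub
  have hcs : σ.crit ⊆ σ.sel := σ.crit_sel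
  have h7 := card_insert_add_card_le hcs b
  have h8 := card_insert_add_card_le
    (((Finset.erase_subset b σ.crit).trans hcs).trans (Finset.subset_insert b σ.sel)) a
  rw [Finset.erase_right_comm, ← h2, ← h1] at h8
  refine ⟨τ, ?_, hsub, by omega⟩
  unfold Balanced at hb ⊢
  rw [h3]
  omega

theorem exists_improves_of_disjoint {σ : Config G} (hb : σ.Balanced) {x : V} (c : G.Walk x x)
    (hc : c.IsCycle) (hcl : ∀ z ∈ c.support, σ.label z = none) :
    ∃ τ : Config G, τ.Improves σ := by
  have hcv : ∀ z ∈ c.support, z ∉ σ.verts := fun z hz hzv => by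
    have := hcl z hz
    rw [σ.label_self z hzv] at this
    cases this
  -- No hanging cycle has to be given up, so `x`, which is not critical, fills that argument. The
  -- selection of `x` is paid for by `base`.
  obtain ⟨τ, h1, h2, h3, -, -, h4, h5, -⟩ :=
    σ.exists_add_cycle x c hc hcv fun z hz => Or.inl (hcl z hz)
  rw [Finset.erase_eq_of_notMem fun h => hcv x c.start_mem_support (σ.crit_verts x h)] at h2
  have hsub : σ.sel ⊆ τ.sel := h1 ▸ Finset.subset_insert _ _
  have h6 := Finset.card_le_card hsub
  have h7 := Finset.card_insert_le x σ.sel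
  rw [← h1] at h7
  refine ⟨τ, ?_, hsub, by omega⟩
  unfold Balanced at hb ⊢
  rw [h2, h3]
  omega

/-- The cycle `c` joins the subgraph, and part of the cycle hanging at `a` becomes an ear from `a`
to `c`. At most two vertices are newly selected, as `a` already was, and one critical vertex is
lost; `base` gains 1 and the ear gains 2. -/
theorem exists_improves_of_crit {σ : Config G} (hb : σ.Balanced) {a x : V} (ha : a ∈ σ.crit)
    (hx : σ.label x = some a) (c : G.Walk x x) (hc : c.IsCycle) (hac : a ∉ c.support)
    (hcl : ∀ z ∈ c.support, σ.label z = none ∨ σ.label z = some a) :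
    ∃ τ : Config G, τ.Improves σ := by
  have hcv : ∀ z ∈ c.support, z ∉ σ.verts := fun z hz hzv => by
    have := hcl z hz
    rw [σ.label_self z hzv] at this
    simp only [reduceCtorEq, Option.some_inj, false_or] at this
    exact hac (this ▸ hz)
  obtain ⟨τ, h1, h2, h3, hv, he, h4, h5, hl⟩ := σ.exists_add_cycle a c hc hcv hcl
  obtain ⟨p, hpl, hpe⟩ := σ.exists_walk_of_label hx
  obtain ⟨w, q, hw, hqs, hqe, hqw⟩ :=
    exists_walk_first_hit p (· ∈ c.support) c.start_mem_support
  have haw : a ≠ w := fun h => hac (h ▸ hw)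
  have hda : edgeDeg τ.edges a ≤ 2 := by
    have h6 := edgeDeg_union_le σ.edges c.edges.toFinset a
    have h7 := edgeDeg_walk_of_notMem c hac
    have h8 := σ.crit_deg a ha
    rw [he]; omega
  have hdw : edgeDeg τ.edges w ≤ 2 := by
    have h6 := edgeDeg_union_le σ.edges c.edges.toFinset w
    have h7 := σ.edgeDeg_eq_zero_of_notMem (hcv w hw)
    have h8 := edgeDeg_cycle c hc w
    rw [he]; omega
  obtain ⟨ρ, k1, k2, k3, k4, k5⟩ := τ.exists_add_ear haw (by rw [hv]; simp [σ.crit_verts a ha])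
    (by rw [hv]; simp [hw]) hda hdw q
    (by
      intro z hz
      have hza := hpl z (hqs z hz)
      rw [hl]
      by_cases hzc : z ∈ c.support
      · simp [hqw z hz hzc, hw]
      · by_cases hzv : z ∈ σ.verts
        · simp [hzc, hza, hzv]
        · simp [hzc, hza, hzv])
    (by
      intro e heq heE
      rw [he, Finset.mem_union, List.mem_toFinset] at heE
      rcases heE with heE | heE
      · exact hpe e (hqe e heq) heE
      · induction e using Sym2.ind with | _ y z =>
        exact (c.adj_of_mem_edges heE).ne
          ((hqw y (q.fst_mem_support_of_mem_edges heq) (c.fst_mem_support_of_mem_edges heE)).trans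
          (hqw z (q.snd_mem_support_of_mem_edges heq) (c.snd_mem_support_of_mem_edges heE)).symm))
  have hsub : σ.sel ⊆ ρ.sel := by
    rw [k1, h1]
    exact ((Finset.subset_insert _ _).trans (Finset.subset_insert _ _)).trans
      (Finset.subset_insert _ _)
  have h6 := Finset.card_le_card hsub
  have h7 : ρ.sel.card ≤ σ.sel.card + 2 := by
    rw [k1, h1, Finset.insert_eq_of_mem (by simp [σ.crit_sel a ha])]
    exact (Finset.card_insert_le _ _).trans (Nat.succ_le_succ (Finset.card_insert_le _ _))
  have h8 : ρ.crit.card + 1 = σ.crit.card := by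
    rw [k2, h2, Finset.erase_idem, Finset.erase_eq_of_notMem, Finset.card_erase_add_one ha]
    exact fun h => hcv w hw (σ.crit_verts w (Finset.mem_of_mem_erase h))
  refine ⟨ρ, ?_, hsub, by omega⟩
  unfold Balanced at hb ⊢
  rw [k3, h3]
  omega

/-- Without ears, a cycle that avoids `sel` and has a vertex labelled `a` meets no other label. If
`a` is critical, it is selected and off the cycle; if not, the cycle passes through `a` and can be
hung there. -/
theorem exists_improves {σ : Config G} (hb : σ.Balanced) (hσ : ¬ HitsCycles G σ.sel) :
    ∃ τ : Config G, τ.Improves σ := by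
  by_cases hear : σ.HasEar
  · exact exists_improves_of_hasEar hb hear
  unfold HitsCycles at hσ
  push Not at hσ
  obtain ⟨v, c, hc, hcs⟩ := hσ
  by_cases hnone : ∀ z ∈ c.support, σ.label z = none
  · exact exists_improves_of_disjoint hb c hc hnone
  push Not at hnone
  obtain ⟨x, hx, hxl⟩ := hnone
  obtain ⟨a, hxa⟩ := Option.ne_none_iff_exists'.1 hxl
  have hc' := hc.rotate hx
  have hcs' : ∀ z ∈ (c.rotate x hx).support, z ∉ σ.sel := fun z hz =>
    hcs z ((c.mem_support_rotate_iff x hx).1 hz)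
  have hcl : ∀ z ∈ (c.rotate x hx).support, σ.label z = none ∨ σ.label z = some a :=
    fun z hz => (reach_of_cycle hear _ hc' hcs' hxa z hz).label
  by_cases ha : a ∈ σ.crit
  · exact exists_improves_of_crit hb ha hxa _ hc' (fun h => hcs' a h (σ.crit_sel a ha)) hcl
  have hax : x = a := by
    by_contra h
    exact ha (σ.label_crit x a hxa h)
  subst hax
  have hxs := hcs x hx
  obtain ⟨τ, h1, h2, h3, h4, h5⟩ :=
    σ.exists_attach_cycle (σ.label_verts x x hxa) hxs _ hc' hcl
  have h6 := Finset.card_insert_of_notMem hxs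
  have h7 := Finset.card_insert_of_notMem ha
  rw [← h1] at h6
  rw [← h2] at h7
  refine ⟨τ, ?_, h1 ▸ Finset.subset_insert _ _, by rw [h5]; omega⟩
  unfold Balanced at hb ⊢
  rw [h3, h4, h5]
  omega

theorem exists_hitsCycles (hG : G.edgeSet.Finite) {F : Finset V} (hF : HitsCycles G F)
    (σ : Config G) (hb : σ.Balanced) :
    ∃ τ : Config G, τ.Balanced ∧ σ.sel ⊆ τ.sel ∧ HitsCycles G τ.sel := by
  -- Every improvement raises |edges| + |sel|, and balance keeps this sum at most |E(G)| + 5|F|.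
  induction hk : hG.toFinset.card + 5 * F.card - (σ.edges.card + σ.sel.card)
    using Nat.strong_induction_on generalizing σ with
  | _ k ih =>
    by_cases hσ : HitsCycles G σ.sel
    · exact ⟨σ, hb, subset_rfl, hσ⟩
    obtain ⟨τ, h1, h2, h3⟩ := exists_improves hb hσ
    have h4 := h1.card_sel_le hF
    have h5 : τ.edges.card ≤ hG.toFinset.card :=
      Finset.card_le_card fun e he => hG.mem_toFinset.2 (τ.edges_sub e he)
    obtain ⟨ρ, k1, k2, k3⟩ := ih _ (by omega) τ h1 rfl
    exact ⟨ρ, k1, h2.trans k2, k3⟩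

/-- The configuration on the empty subgraph. -/
def empty (G : SimpleGraph V) : Config G where
  sel := ∅
  verts := ∅
  edges := ∅
  crit := ∅
  label := fun _ => none
  base := 0
  edges_sub := by simp
  mem_verts := by simp
  deg_le_three := by simp [edgeDeg]
  deg_le_two := by simp [edgeDeg]
  crit_deg := by simp
  crit_sel := by simp
  crit_verts := by simp
  label_self := by simp
  label_verts := by simp
  label_crit := by simp
  crit_cycle := by simp
  base_le := by simp
  hits := fun v c hc h => by
    obtain ⟨y, -, -, hy, -⟩ := exists_two_edges_of_isCycle hc c.start_mem_support
    simpa using h _ hy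

theorem empty_balanced (G : SimpleGraph V) : (empty G).Balanced := by
  simp [Balanced, empty]

/-- A configuration of a graph is a configuration of every larger graph. -/
def mono {G' : SimpleGraph V} (h : G ≤ G') (σ : Config G) : Config G' where
  sel := σ.sel
  verts := σ.verts
  edges := σ.edges
  crit := σ.crit
  label := σ.label
  base := σ.base
  edges_sub := fun e he => edgeSet_mono h (σ.edges_sub e he)
  mem_verts := σ.mem_verts
  deg_le_three := σ.deg_le_three
  deg_le_two := σ.deg_le_two
  crit_deg := σ.crit_deg
  crit_sel := σ.crit_sel
  crit_verts := σ.crit_verts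
  label_self := σ.label_self
  label_verts := σ.label_verts
  label_crit := σ.label_crit
  crit_cycle := fun u hu => by
    obtain ⟨c, hc, hcl⟩ := σ.crit_cycle u hu
    exact ⟨c.mapLe h, hc.mapLe h, by simpa using hcl⟩
  base_le := fun F hF => σ.base_le F fun v c hc => by
    simpa using hF v (c.mapLe h) (hc.mapLe h)
  -- A cycle of `G'` inside the subgraph is already a cycle of `G`, because the edges of the
  -- subgraph lie in `G`.
  hits := fun v c hc hce => by
    have hG : ∀ e ∈ c.edges, e ∈ G.edgeSet := fun e he => σ.edges_sub e (hce e he)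
    simpa using σ.hits v (c.transfer G hG) (hc.transfer hG) (by simpa using hce)

end Config

/-! ### The online algorithm -/

/-- The revealed graph as a graph on the natural numbers. -/
def natGraph {n : ℕ} (G : SimpleGraph (Fin n)) : SimpleGraph ℕ := G.map Fin.valEmbedding

theorem natGraph_adj {n : ℕ} {G : SimpleGraph (Fin n)} {x y : ℕ} :
    (natGraph G).Adj x y ↔ ∃ (hx : x < n) (hy : y < n), G.Adj ⟨x, hx⟩ ⟨y, hy⟩ := by
  unfold natGraph
  rw [SimpleGraph.map_adj]
  constructor
  · rintro ⟨u, v, h, rfl, rfl⟩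
    exact ⟨u.2, v.2, h⟩
  · rintro ⟨hx, hy, h⟩
    exact ⟨_, _, h, rfl, rfl⟩

theorem natGraph_revealed_le {n i : ℕ} (G : SimpleGraph (Fin n)) (hi : i ≤ n) :
    natGraph (revealed G i hi) ≤ natGraph G := by
  intro x y h
  obtain ⟨hx, hy, h⟩ := natGraph_adj.1 h
  exact natGraph_adj.2 ⟨hx.trans_le hi, hy.trans_le hi, h⟩

theorem natGraph_finite {n : ℕ} (G : SimpleGraph (Fin n)) : (natGraph G).edgeSet.Finite := by
  unfold natGraph
  rw [SimpleGraph.edgeSet_map]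
  exact (Set.toFinite _).image _

theorem lt_of_mem_cycle {n : ℕ} {G : SimpleGraph (Fin n)} {v : ℕ} {c : (natGraph G).Walk v v}
    (hc : c.IsCycle) {x : ℕ} (hx : x ∈ c.support) : x < n := by
  obtain ⟨y, -, -, hy, -⟩ := exists_two_edges_of_isCycle hc hx
  exact (natGraph_adj.1 (c.adj_of_mem_edges hy)).choose

theorem hitsCycles_range {n : ℕ} (G : SimpleGraph (Fin n)) :
    HitsCycles (natGraph G) (Finset.range n) := fun v _ hc =>
  ⟨v, Walk.start_mem_support _, Finset.mem_range.2 (lt_of_mem_cycle hc (Walk.start_mem_support _))⟩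

theorem IsFVS.hitsCycles {n : ℕ} {G : SimpleGraph (Fin n)} {F : Finset (Fin n)}
    (hF : IsFVS G (F : Set (Fin n))) : HitsCycles (natGraph G) (F.map Fin.valEmbedding) := by
  intro v c hc
  by_contra! hcon
  let T : Set ℕ := {x | ∃ hx : x < n, (⟨x, hx⟩ : Fin n) ∉ F}
  have hT : ∀ x ∈ c.support, x ∈ T := fun x hx =>
    ⟨lt_of_mem_cycle hc hx, fun h => hcon x hx (Finset.mem_map.2 ⟨_, h, rfl⟩)⟩
  let f : (natGraph G).induce T →g G.induce (F : Set (Fin n))ᶜ :=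
    { toFun := fun x => ⟨⟨x.1, x.2.choose⟩, x.2.choose_spec⟩
      map_rel' := fun {x y} h => (natGraph_adj.1 h).choose_spec.choose_spec }
  have hf : Function.Injective f := fun x y h => by
    have := congrArg (fun z => z.1.1) h
    exact Subtype.ext this
  refine (IsAcyclic.comap f hf hF) (c.induce T hT)
    (Walk.IsCycle.of_map (f := (Embedding.induce T).toHom) ?_)
  rw [Walk.map_induce]
  exact hc

/-- The configurations kept by the online algorithm. -/
noncomputable def stage : (i : ℕ) → (G : SimpleGraph (Fin i)) →
    {σ : Config (natGraph G) // σ.Balanced}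
  | 0, _ => ⟨Config.empty _, Config.empty_balanced _⟩
  | i + 1, G =>
    -- The set of all vertices only ensures termination here; the bound by the optimum follows from
    -- balance alone.
    let h := Config.exists_hitsCycles (natGraph_finite G) (hitsCycles_range G)
      ((stage i (revealed G i i.le_succ)).1.mono (natGraph_revealed_le G i.le_succ))
      (stage i (revealed G i i.le_succ)).2
    ⟨h.choose, h.choose_spec.1⟩

/-- The vertices chosen by the online algorithm. -/
noncomputable def chosen {i : ℕ} (G : SimpleGraph (Fin i)) : Finset ℕ := (stage i G).1.sel

theorem chosen_subset_succ {i : ℕ} (G : SimpleGraph (Fin (i + 1))) :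
    chosen (revealed G i i.le_succ) ⊆ chosen G :=
  (Config.exists_hitsCycles (natGraph_finite G) (hitsCycles_range G)
      ((stage i (revealed G i i.le_succ)).1.mono (natGraph_revealed_le G i.le_succ))
      (stage i (revealed G i i.le_succ)).2).choose_spec.2.1

theorem chosen_hitsCycles {i : ℕ} (G : SimpleGraph (Fin i)) :
    HitsCycles (natGraph G) (chosen G) := by
  cases i with
  | zero => exact fun v c hc => absurd (lt_of_mem_cycle hc c.start_mem_support) (by omega)
  | succ i =>
    exact (Config.exists_hitsCycles (natGraph_finite G) (hitsCycles_range G)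
      ((stage i (revealed G i i.le_succ)).1.mono (natGraph_revealed_le G i.le_succ))
      (stage i (revealed G i i.le_succ)).2).choose_spec.2.2

theorem card_chosen_le {n : ℕ} (G : SimpleGraph (Fin n)) : (chosen G).card ≤ 5 * opt G := by
  obtain ⟨F, hF, hcard⟩ := opt_spec G
  have := (stage n G).2.card_sel_le hF.hitsCycles
  rwa [Finset.card_map, hcard] at this

theorem chosen_mono {n : ℕ} (G : SimpleGraph (Fin n)) {i j : ℕ} (hij : i ≤ j) (hj : j ≤ n) :
    chosen (revealed G i (hij.trans hj)) ⊆ chosen (revealed G j hj) := by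
  induction j, hij using Nat.le_induction with
  | base => exact subset_rfl
  | succ j hij ih =>
    exact (ih (j.le_succ.trans hj)).trans (chosen_subset_succ (revealed G (j + 1) hj))

/-- The chosen vertices as a set of vertices of the revealed graph. -/
noncomputable def pick (i : ℕ) (G : SimpleGraph (Fin i)) : Finset (Fin i) :=
  Finset.univ.filter fun v => v.val ∈ chosen G

theorem mem_map_pick {n : ℕ} (G : SimpleGraph (Fin n)) {i : ℕ} (hi : i ≤ n) {v : Fin n} :
    v ∈ (pick i (revealed G i hi)).map (Fin.castLEEmb hi) ↔
      v.val < i ∧ v.val ∈ chosen (revealed G i hi) := by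
  simp only [pick, Finset.mem_map, Finset.mem_filter, Finset.mem_univ, true_and]
  constructor
  · rintro ⟨u, hu, rfl⟩
    exact ⟨u.2, hu⟩
  · rintro ⟨h, hv⟩
    exact ⟨⟨v.val, h⟩, hv, rfl⟩

theorem map_pick_mono {n : ℕ} (G : SimpleGraph (Fin n)) {i j : ℕ} (hij : i ≤ j) (hj : j ≤ n) :
    (pick i (revealed G i (hij.trans hj))).map (Fin.castLEEmb (hij.trans hj)) ⊆
      (pick j (revealed G j hj)).map (Fin.castLEEmb hj) := by
  intro v hv
  rw [mem_map_pick] at hv ⊢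
  exact ⟨hv.1.trans_le hij, chosen_mono G hij hj hv.2⟩

theorem isAcyclic_induce_of_notMem_pick {n : ℕ} (G : SimpleGraph (Fin n)) {i : ℕ} (hi : i ≤ n)
    {T : Set (Fin n)} (hT : ∀ v ∈ T, v.val < i ∧
      v ∉ (pick i (revealed G i hi)).map (Fin.castLEEmb hi)) : (G.induce T).IsAcyclic := by
  intro v c hc
  let f : G.induce T →g natGraph (revealed G i hi) :=
    { toFun := fun x => x.1.1
      map_rel' := fun {x y} h => natGraph_adj.2 ⟨(hT x x.2).1, (hT y y.2).1, h⟩ }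
  have hf : Function.Injective f := fun x y h => Subtype.ext (Fin.ext h)
  obtain ⟨y, hy, hyc⟩ := chosen_hitsCycles (revealed G i hi) _ (c.map f) (hc.map hf)
  rw [Walk.support_map, List.mem_map] at hy
  obtain ⟨z, -, rfl⟩ := hy
  exact (hT z z.2).2 ((mem_map_pick G hi).2 ⟨(hT z z.2).1, hyc⟩)

theorem card_map_pick_le {n : ℕ} (G : SimpleGraph (Fin n)) :
    ((pick n (revealed G n le_rfl)).map (Fin.castLEEmb le_rfl)).card ≤ 5 * opt G := by
  rw [Finset.card_map]
  refine le_trans ?_ (card_chosen_le G)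
  rw [← Finset.card_map Fin.valEmbedding]
  refine Finset.card_le_card fun x hx => ?_
  obtain ⟨v, hv, rfl⟩ := Finset.mem_map.1 hx
  exact (Finset.mem_filter.1 hv).2

/-! ### The two strategies and their competitive ratios -/

/-- The algorithm that selects the chosen vertices. -/
noncomputable def selectStrategy : OnlineStrategy where
  select := pick
  reserve := fun _ _ => ∅

/-- The algorithm that reserves the chosen vertices. -/
noncomputable def reserveStrategy : OnlineStrategy where
  select := fun _ _ => ∅
  reserve := pick

theorem selectStrategy_isAlgorithm : selectStrategy.IsAlgorithm where
  selected_mono := fun _ G _ _ hij hj => map_pick_mono G hij hj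
  reserved_mono := fun _ _ _ _ _ _ => by simp [OnlineStrategy.reserved, selectStrategy]
  valid := fun _ G _ hi => isAcyclic_induce_of_notMem_pick G hi fun _ hv => ⟨hv.1, hv.2.1⟩

theorem reserveStrategy_isAlgorithm : reserveStrategy.IsAlgorithm where
  selected_mono := fun _ _ _ _ _ _ => by simp [OnlineStrategy.selected, reserveStrategy]
  reserved_mono := fun _ G _ _ hij hj => map_pick_mono G hij hj
  valid := fun _ G _ hi => isAcyclic_induce_of_notMem_pick G hi fun _ hv => ⟨hv.1, hv.2.2⟩

theorem completionSize_eq_zero {n : ℕ} {G : SimpleGraph (Fin n)} {S : Finset (Fin n)}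
    (hS : IsFVS G (S : Set (Fin n))) : completionSize G S = 0 :=
  Nat.le_zero.1 (Nat.sInf_le ⟨∅, by simpa using hS, rfl⟩)

theorem completionSize_empty {n : ℕ} (G : SimpleGraph (Fin n)) : completionSize G ∅ = opt G := by
  simp [completionSize, opt]

theorem selectStrategy_isCompetitive (α : ℝ) : selectStrategy.IsCompetitive α 5 := by
  intro n G
  have h1 : completionSize G (selectStrategy.selected G n le_rfl) = 0 :=
    completionSize_eq_zero (isAcyclic_induce_of_notMem_pick G le_rfl fun v hv => ⟨v.2, hv⟩)
  have h2 : (selectStrategy.selected G n le_rfl).card ≤ 5 * opt G := card_map_pick_le G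
  have h3 : selectStrategy.reserved G n le_rfl = ∅ := by
    simp [OnlineStrategy.reserved, selectStrategy]
  unfold OnlineStrategy.cost
  rw [h1, h3]
  have h4 : ((selectStrategy.selected G n le_rfl).card : ℝ) ≤ 5 * opt G := by exact_mod_cast h2
  simpa using h4

theorem reserveStrategy_isCompetitive {α : ℝ} (hα : 0 ≤ α) :
    reserveStrategy.IsCompetitive α (1 + 5 * α) := by
  intro n G
  have h1 : reserveStrategy.selected G n le_rfl = ∅ := by
    simp [OnlineStrategy.selected, reserveStrategy]
  have h2 : (reserveStrategy.reserved G n le_rfl).card ≤ 5 * opt G := card_map_pick_le G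
  have h3 : ((reserveStrategy.reserved G n le_rfl).card : ℝ) ≤ 5 * opt G := by exact_mod_cast h2
  have h4 := mul_le_mul_of_nonneg_left h3 hα
  unfold OnlineStrategy.cost
  rw [h1, completionSize_empty, Finset.card_empty]
  push_cast
  linarith

end DelayedFVS

theorem mainTheorem7 (α : ℝ) (hα : 0 ≤ α) :
    ∃ A : DelayedFVS.OnlineStrategy,
      A.IsAlgorithm ∧ A.IsCompetitive α (min 5 (1 + 5 * α)) := by
  -- Selecting is the better choice from α = 4/5 on, reserving below.
  rcases le_total 5 (1 + 5 * α) with h | h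
  · rw [min_eq_left h]
    exact ⟨_, DelayedFVS.selectStrategy_isAlgorithm, DelayedFVS.selectStrategy_isCompetitive α⟩
  · rw [min_eq_right h]
    exact ⟨_, DelayedFVS.reserveStrategy_isAlgorithm, DelayedFVS.reserveStrategy_isCompetitive hα⟩
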